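/- Let $\rho_0,\rho_1$ be density operators (positive semidefinite, trace one) on a finite-dimensional complex Hilbert space, and suppose that $\ker\rho_1\subseteq\ker\rho_0$ (for instance, that both are invertible). A POVM is a finite family $\{E_b\}_{b=1}^n$, with any number $n$ of outcomes, of positive semidefinite operators with $\sum_b E_b=1$. For a POVM put $p_i(b)=\mathrm{tr}(\rho_iE_b)$ and $$K(p_0/p_1)=\sum_b p_0(b)\ln\frac{p_0(b)}{p_1(b)}$$ (terms with $p_0(b)=0$ count as $0$). Define the quantum Kullback information $K(\rho_0/\rho_1)=\sup_{\{E_b\}}K(p_0/p_1)$, the supremum over all POVMs, and the Umegaki relative information $K_{\rm U}(\rho_0/\rho_1)=\mathrm{tr}(\rho_0\ln\rho_0-\rho_0\ln\rho_1)$, where $0\ln 0=0$ and $\ln\rho_1$ is taken on the support of $\rho_1$. Then: 1. for every POVM, $K(p_0/p_1)\le K_{\rm U}(\rho_0/\rho_1)$; 2. consequently $K(\rho_0/\rho_1)\le K_{\rm U}(\rho_0/\rho_1)$; 3. $K(\rho_0/\rho_1)=K_{\rm U}(\rho_0/\rho_1)$ if and only if $\rho_0$ and $\rho_1$ commute; 4.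 some POVM attains $K(p_0/p_1)=K_{\rm U}(\rho_0/\rho_1)$ if and only if $\rho_0$ and $\rho_1$ commute. -/

import Mathlib

open scoped ComplexOrder

/-- A density operator on the finite-dimensional Hilbert space `ℂ^d`: a positive semidefinite
matrix of trace one. -/
structure DensityMatrix (d : Type*) [Fintype d] where
  /-- the underlying matrix -/
  mat : Matrix d d ℂ
  posSemidef : mat.PosSemidef
  trace_eq_one : mat.trace = 1

/-- A POVM on `ℂ^d` with `n` outcomes: positive semidefinite matrices `E b` that sum to the
identity. -/
structure POVM (d : Type*) [Fintype d] [DecidableEq d] (n : ℕ) where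
  /-- the operator that belongs to the outcome `b` -/
  effect : Fin n → Matrix d d ℂ
  posSemidef : ∀ b, (effect b).PosSemidef
  sum_eq_one : ∑ b, effect b = 1

/-- The outcome distribution `p(b) = tr (ρ E_b)`; the trace is a real number, recorded by its
real part. -/
noncomputable def POVM.prob {d : Type*} [Fintype d] [DecidableEq d] {n : ℕ}
    (E : POVM d n) (ρ : DensityMatrix d) (b : Fin n) : ℝ :=
  (ρ.mat * E.effect b).trace.re

/-- The Kullback-Leibler relative information `K(p/q) = ∑_b p(b) ln (p(b)/q(b))`. Terms with
`p(b) = 0` vanish; the value is meaningful when `q(b) = 0` implies `p(b) = 0`. -/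
noncomputable def klInformation {n : ℕ} (p q : Fin n → ℝ) : ℝ :=
  ∑ b, p b * Real.log (p b / q b)

/-- The quantum Kullback information `K(ρ₀/ρ₁)`: the supremum over all POVMs, with any finite
number of outcomes, of the Kullback-Leibler information of the outcome distributions. -/
noncomputable def quantumKullback {d : Type*} [Fintype d] [DecidableEq d]
    (ρ₀ ρ₁ : DensityMatrix d) : ℝ :=
  sSup {x : ℝ | ∃ (n : ℕ) (E : POVM d n), x = klInformation (E.prob ρ₀) (E.prob ρ₁)}

/-- The Umegaki relative information `K_U(ρ₀/ρ₁) = tr (ρ₀ ln ρ₀ - ρ₀ ln ρ₁)`. The logarithm is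
that of the functional calculus; since `Real.log 0 = 0`, it is the logarithm on the support and
zero on the kernel, which gives `0 ln 0 = 0` in the first term and the usual value of the second
term when `ker ρ₁ ⊆ ker ρ₀`. -/
noncomputable def umegakiInformation {d : Type*} [Fintype d] [DecidableEq d]
    (ρ₀ ρ₁ : DensityMatrix d) : ℝ :=
  (ρ₀.mat * cfc Real.log ρ₀.mat - ρ₀.mat * cfc Real.log ρ₁.mat).trace.re

/-!
The relative information `∑ p ln (p / q)` is the increment over `[0, 1]` of the function
`t ↦ ∑ p ln (t p + (1 - t) q)`, whose derivative is `(1 - t) χ_t(p, q)` with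
`χ_t(p, q) = ∑ (p - q)² / (t p + (1 - t) q)`. If `ρ₀` and `ρ₁` have eigenbases `u`, `v` and
eigenvalues `a`, `b`, then the Umegaki information is the relative information of the
Nussbaum-Szkoła distributions `P(i, j) = a_i |⟨u_i, v_j⟩|²` and `Q(i, j) = b_j |⟨u_i, v_j⟩|²`.
It therefore suffices to compare `χ_t(p₀, p₁)` with `χ_t(P, Q)`.

With the score `c_k = (p₀(k) - p₁(k)) / (t p₀(k) + (1 - t) p₁(k))` and `X = ∑ c_k E_k`, the operator
inequality `X² ≤ ∑ c_k² E_k` gives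
`χ_t(p₀, p₁) ≤ 2 tr ((ρ₀ - ρ₁) X) - tr ((t ρ₀ + (1 - t) ρ₁) X²)`, and completing the square entry by
entry in the bases `u`, `v` bounds the right-hand side by `χ_t(P, Q)`. As `t → 0`, the deficit
controls `T = (1 - t) X ρ₁ - (ρ₀ - ρ₁)`, while `ρ₁ T - T* ρ₁ = ρ₀ ρ₁ - ρ₁ ρ₀`. So a nonzero
commutator forces `χ_t(p₀, p₁) + ‖ρ₀ ρ₁ - ρ₁ ρ₀‖² / 4 ≤ (1 + t) χ_t(P, Q)`, and hence a gap between
the informations that does not depend on the POVM. If the operators commute, their joint spectral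
measurement attains the Umegaki information.
-/

open Matrix

section RelativeInformation

variable {ι κ : Type*} [Fintype ι] [Fintype κ] {p q : ι → ℝ} {p' q' : κ → ℝ} {t : ℝ}

/-- Two finite measures of equal mass, given by their weights, the first of which is absolutely
continuous with respect to the second. -/
structure IsDominatedPair (p q : ι → ℝ) : Prop where
  fst_nonneg : ∀ i, 0 ≤ p i
  snd_nonneg : ∀ i, 0 ≤ q i
  sum_eq : ∑ i, p i = ∑ i, q i
  fst_eq_zero : ∀ i, q i = 0 → p i = 0

/-- The Kullback-Leibler relative information of two families of weights over any finite index
type; over `Fin n` it is `klInformation` by definition. -/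
noncomputable def relativeInformation (p q : ι → ℝ) : ℝ :=
  ∑ i, p i * Real.log (p i / q i)

/-- The integral with respect to `p` of the logarithm of the mixture `t p + (1 - t) q`. -/
noncomputable def logMixture (p q : ι → ℝ) (t : ℝ) : ℝ :=
  ∑ i, p i * Real.log (t * p i + (1 - t) * q i)

/-- The `χ²`-divergence of `p` and `q` relative to their mixture `t p + (1 - t) q`. Terms where
the mixture vanishes are zero by the convention `x / 0 = 0`, the correct value for `p, q ≥ 0` and
`0 < t < 1`, since then `p` and `q` vanish as well. -/
noncomputable def chiSq (p q : ι → ℝ) (t : ℝ) : ℝ :=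
  ∑ i, (p i - q i) ^ 2 / (t * p i + (1 - t) * q i)

theorem hasDerivAt_mul_log_mixture {a b : ℝ} (ha : 0 ≤ a) (hb : 0 ≤ b) (ht : t ∈ Set.Ioo 0 1) :
    HasDerivAt (fun s => a * Real.log (s * a + (1 - s) * b))
      ((a - b) + (1 - t) * ((a - b) ^ 2 / (t * a + (1 - t) * b))) t := by
  have ht' : 0 < 1 - t := sub_pos.2 ht.2
  rcases ha.eq_or_lt with rfl | ha
  · have hzero : (0 - b) + (1 - t) * ((0 - b) ^ 2 / (t * 0 + (1 - t) * b)) = 0 := by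
      rcases hb.eq_or_lt with rfl | hb
      · simp
      · field_simp
        ring
    simpa only [zero_mul, hzero] using hasDerivAt_const t (0 : ℝ)
  · have hr : 0 < t * a + (1 - t) * b :=
      add_pos_of_pos_of_nonneg (mul_pos ht.1 ha) (mul_nonneg ht'.le hb)
    have hmix : HasDerivAt (fun s => s * a + (1 - s) * b) (1 * a + -1 * b) t :=
      ((hasDerivAt_id t).mul_const a).add (((hasDerivAt_id t).const_sub 1).mul_const b)
    refine ((hmix.log hr.ne').const_mul a).congr_deriv ?_
    rw [mul_div_assoc', mul_div_assoc', div_eq_iff hr.ne', add_mul, div_mul_cancel₀ _ hr.ne']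
    ring

namespace IsDominatedPair

theorem relativeInformation_eq (h : IsDominatedPair p q) :
    relativeInformation p q = logMixture p q 1 - logMixture p q 0 := by
  simp only [relativeInformation, logMixture, one_mul, sub_self, zero_mul, add_zero, zero_add,
    sub_zero, ← Finset.sum_sub_distrib]
  refine Finset.sum_congr rfl fun i _ => ?_
  by_cases hi : p i = 0
  · simp [hi]
  · rw [Real.log_div hi fun hq => hi (h.fst_eq_zero i hq), mul_sub]

theorem hasDerivAt_logMixture (h : IsDominatedPair p q) (ht : t ∈ Set.Ioo 0 1) :
    HasDerivAt (logMixture p q) ((1 - t) * chiSq p q t) t := by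
  refine (HasDerivAt.fun_sum fun i _ =>
    hasDerivAt_mul_log_mixture (h.fst_nonneg i) (h.snd_nonneg i) ht).congr_deriv ?_
  rw [Finset.sum_add_distrib, Finset.sum_sub_distrib, h.sum_eq, sub_self, zero_add, chiSq,
    Finset.mul_sum]

theorem continuousOn_logMixture (h : IsDominatedPair p q) :
    ContinuousOn (logMixture p q) (Set.Icc 0 1) := by
  refine continuousOn_finsetSum _ fun i _ => ?_
  rcases (h.fst_nonneg i).eq_or_lt with hp | hp
  · simpa only [← hp, zero_mul] using continuousOn_const
  · have hq : 0 < q i := (h.snd_nonneg i).lt_of_ne' fun hq => hp.ne' (h.fst_eq_zero i hq)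
    refine continuousOn_const.mul (ContinuousOn.log (by fun_prop) fun t ht => ne_of_gt ?_)
    rcases ht.1.eq_or_lt with rfl | ht0
    · simpa using hq
    · exact add_pos_of_pos_of_nonneg (mul_pos ht0 hp) (mul_nonneg (sub_nonneg.2 ht.2) hq.le)

theorem chiSq_nonneg (h : IsDominatedPair p q) (ht : t ∈ Set.Icc 0 1) : 0 ≤ chiSq p q t :=
  Finset.sum_nonneg fun i _ => div_nonneg (sq_nonneg _) <| add_nonneg
    (mul_nonneg ht.1 (h.fst_nonneg i)) (mul_nonneg (sub_nonneg.2 ht.2) (h.snd_nonneg i))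

theorem chiSq_le_two_mul_chiSq_zero (h : IsDominatedPair p q) (ht : t ∈ Set.Icc 0 (1 / 2)) :
    chiSq p q t ≤ 2 * chiSq p q 0 := by
  rw [chiSq, chiSq, Finset.mul_sum]
  refine Finset.sum_le_sum fun i _ => ?_
  rcases (h.snd_nonneg i).eq_or_lt with hq | hq
  · simp [← hq, h.fst_eq_zero i hq.symm]
  · have hhalf : q i / 2 ≤ t * p i + (1 - t) * q i := by
      nlinarith [mul_nonneg ht.1 (h.fst_nonneg i), ht.2]
    calc (p i - q i) ^ 2 / (t * p i + (1 - t) * q i)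
        ≤ (p i - q i) ^ 2 / (q i / 2) := by gcongr
      _ = 2 * ((p i - q i) ^ 2 / (0 * p i + (1 - 0) * q i)) := by
        rw [zero_mul, sub_zero, one_mul, zero_add, div_div_eq_mul_div]
        ring

theorem monotoneOn_logMixture_sub (h : IsDominatedPair p q) (h' : IsDominatedPair p' q')
    (hle : ∀ t ∈ Set.Ioo (0 : ℝ) 1, chiSq p' q' t ≤ chiSq p q t) :
    MonotoneOn (fun t => logMixture p q t - logMixture p' q' t) (Set.Icc 0 1) := by
  have hderiv := fun (t : ℝ) (ht : t ∈ Set.Ioo 0 1) =>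
    (h.hasDerivAt_logMixture ht).sub (h'.hasDerivAt_logMixture ht)
  refine monotoneOn_of_hasDerivWithinAt_nonneg (convex_Icc 0 1)
    (h.continuousOn_logMixture.sub h'.continuousOn_logMixture)
    (fun t ht => (hderiv t (interior_Icc.subset ht)).hasDerivWithinAt) fun t ht => ?_
  rw [interior_Icc] at ht
  exact sub_nonneg.2 (mul_le_mul_of_nonneg_left (hle t ht) (sub_nonneg.2 ht.2.le))

theorem relativeInformation_le_of_chiSq_le (h : IsDominatedPair p q) (h' : IsDominatedPair p' q')
    (hle : ∀ t ∈ Set.Ioo (0 : ℝ) 1, chiSq p' q' t ≤ chiSq p q t) :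
    relativeInformation p' q' ≤ relativeInformation p q := by
  have hmono := monotoneOn_logMixture_sub h h' hle ⟨le_rfl, zero_le_one⟩ ⟨zero_le_one, le_rfl⟩
    zero_le_one
  rw [h.relativeInformation_eq, h'.relativeInformation_eq]
  linarith

theorem relativeInformation_add_le (h : IsDominatedPair p q) (h' : IsDominatedPair p' q')
    (hle : ∀ t ∈ Set.Ioo (0 : ℝ) 1, chiSq p' q' t ≤ chiSq p q t) {g s : ℝ} (hg : 0 ≤ g)
    (hs : s ∈ Set.Icc 0 (1 / 2)) (hgap : ∀ t ∈ Set.Ioo 0 s, chiSq p' q' t + g ≤ chiSq p q t) :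
    relativeInformation p' q' + g / 2 * s ≤ relativeInformation p q := by
  have hs1 : s ≤ 1 := hs.2.trans (by norm_num)
  have hcont := h.continuousOn_logMixture.sub h'.continuousOn_logMixture
  have hderiv := fun (t : ℝ) (ht : t ∈ Set.Ioo 0 s) =>
    have ht' : t ∈ Set.Ioo 0 1 := ⟨ht.1, ht.2.trans_le hs1⟩
    (h.hasDerivAt_logMixture ht').sub (h'.hasDerivAt_logMixture ht')
  have hinit : g / 2 * (s - 0) ≤ _ :=
    Convex.mul_sub_le_image_sub_of_le_deriv (convex_Icc 0 s)
      (hcont.mono (Set.Icc_subset_Icc_right hs1))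
      (fun t ht => (hderiv t (interior_Icc.subset ht)).differentiableAt.differentiableWithinAt)
      (fun t ht => by
        rw [interior_Icc] at ht
        rw [(hderiv t ht).deriv]
        nlinarith [hgap t ht, ht.2, hs.2])
      0 ⟨le_rfl, hs.1⟩ s ⟨hs.1, le_rfl⟩ hs.1
  have hmono := monotoneOn_logMixture_sub h h' hle ⟨hs.1, hs1⟩ ⟨zero_le_one, le_rfl⟩ hs1
  rw [h.relativeInformation_eq, h'.relativeInformation_eq]
  simp only [Pi.sub_apply, sub_zero] at hinit hmono
  linarith

theorem relativeInformation_add_le_of_chiSq_add_le (h : IsDominatedPair p q)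
    (h' : IsDominatedPair p' q') (hle : ∀ t ∈ Set.Ioo (0 : ℝ) 1, chiSq p' q' t ≤ chiSq p q t)
    {c : ℝ} (hc : 0 ≤ c)
    (hgap : ∀ t ∈ Set.Ioo (0 : ℝ) 1, chiSq p' q' t + c ≤ (1 + t) * chiSq p q t) :
    relativeInformation p' q' + c / 4 * min (1 / 2) (c / (4 * chiSq p q 0 + 1)) ≤
      relativeInformation p q := by
  have hχ : 0 ≤ chiSq p q 0 := h.chiSq_nonneg ⟨le_rfl, zero_le_one⟩
  set s := min (1 / 2) (c / (4 * chiSq p q 0 + 1))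
  have hs : s ∈ Set.Icc 0 (1 / 2) := ⟨by positivity, min_le_left _ _⟩
  have hsc : s * (4 * chiSq p q 0 + 1) ≤ c :=
    (le_div_iff₀ (by positivity)).1 (min_le_right _ _)
  have hgap_near_zero : ∀ t ∈ Set.Ioo 0 s, chiSq p' q' t + c / 2 ≤ chiSq p q t := by
    intro t ht
    have ht_half : t ∈ Set.Icc 0 (1 / 2) := ⟨ht.1.le, ht.2.le.trans hs.2⟩
    have herror : t * chiSq p q t ≤ c / 2 :=
      calc t * chiSq p q t ≤ s * (2 * chiSq p q 0) :=
            mul_le_mul ht.2.le (h.chiSq_le_two_mul_chiSq_zero ht_half)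
              (h.chiSq_nonneg ⟨ht.1.le, ht_half.2.trans (by norm_num)⟩) hs.1
        _ ≤ c / 2 := by linarith [hs.1]
    linarith [hgap t ⟨ht.1, ht_half.2.trans_lt (by norm_num)⟩]
  linarith [relativeInformation_add_le h h' hle (div_nonneg hc zero_le_two) hs hgap_near_zero]

end IsDominatedPair

/-- The derivative in `t` of the log-likelihood of the mixture `t p + (1 - t) q`, that is, its
score function. -/
noncomputable def mixtureScore (p q : ι → ℝ) (t : ℝ) (i : ι) : ℝ :=
  (p i - q i) / (t * p i + (1 - t) * q i)

theorem chiSq_eq_sum_mixtureScore (p q : ι → ℝ) (t : ℝ) :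
    chiSq p q t =
      2 * (∑ i, mixtureScore p q t i * p i - ∑ i, mixtureScore p q t i * q i) -
        (t * ∑ i, mixtureScore p q t i ^ 2 * p i +
          (1 - t) * ∑ i, mixtureScore p q t i ^ 2 * q i) := by
  simp only [chiSq, Finset.mul_sum, ← Finset.sum_sub_distrib, ← Finset.sum_add_distrib]
  refine Finset.sum_congr rfl fun i _ => ?_
  by_cases hr : t * p i + (1 - t) * q i = 0
  · simp [mixtureScore, hr]
  · have hscore : mixtureScore p q t i * (t * p i + (1 - t) * q i) = p i - q i :=
      div_mul_cancel₀ _ hr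
    have hchi : (p i - q i) ^ 2 / (t * p i + (1 - t) * q i) =
        mixtureScore p q t i * (p i - q i) := by
      rw [mixtureScore, pow_two, mul_div_right_comm]
    rw [hchi]
    linear_combination mixtureScore p q t i * hscore

end RelativeInformation

section EigenbasisCoefficients

variable {d : Type*} [Fintype d] [DecidableEq d] {A B : Matrix d d ℂ}

/-- The coefficients `⟨u_i, Z v_j⟩` of a matrix `Z`, where `u` and `v` are the orthonormal
eigenbases of the Hermitian matrices `A` and `B`. -/
noncomputable def eigenCoeff (hA : A.IsHermitian) (hB : B.IsHermitian) :
    Matrix d d ℂ →ₗ[ℂ] d × d → ℂ where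
  toFun Z k := (star (hA.eigenvectorUnitary : Matrix d d ℂ) * Z * hB.eigenvectorUnitary) k.1 k.2
  map_add' Z W := by
    ext k
    simp only [mul_add, add_mul, Matrix.add_apply, Pi.add_apply]
  map_smul' c Z := by
    ext k
    simp only [mul_smul_comm, smul_mul_assoc, Matrix.smul_apply, Pi.smul_apply, RingHom.id_apply]

variable (hA : A.IsHermitian) (hB : B.IsHermitian)

theorem eigenCoeff_apply (Z : Matrix d d ℂ) (k : d × d) :
    eigenCoeff hA hB Z k = (star (hA.eigenvectorUnitary : Matrix d d ℂ) * Z *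
      (hB.eigenvectorUnitary : Matrix d d ℂ)) k.1 k.2 :=
  rfl

theorem eigenCoeff_cfc_mul (f : ℝ → ℝ) (Z : Matrix d d ℂ) (k : d × d) :
    eigenCoeff hA hB (cfc f A * Z) k = f (hA.eigenvalues k.1) * eigenCoeff hA hB Z k := by
  have hcfc : star (hA.eigenvectorUnitary : Matrix d d ℂ) * cfc f A =
      diagonal (fun i => (f (hA.eigenvalues i) : ℂ)) *
        star (hA.eigenvectorUnitary : Matrix d d ℂ) := by
    rw [hA.cfc_eq, IsHermitian.cfc, Unitary.conjStarAlgAut_apply, ← mul_assoc, ← mul_assoc,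
      Unitary.coe_star_mul_self, one_mul]
    rfl
  rw [eigenCoeff_apply, eigenCoeff_apply, ← mul_assoc, hcfc, mul_assoc, mul_assoc, diagonal_mul,
    mul_assoc]

theorem eigenCoeff_mul_cfc (f : ℝ → ℝ) (Z : Matrix d d ℂ) (k : d × d) :
    eigenCoeff hA hB (Z * cfc f B) k = f (hB.eigenvalues k.2) * eigenCoeff hA hB Z k := by
  have hcfc : cfc f B * (hB.eigenvectorUnitary : Matrix d d ℂ) =
      hB.eigenvectorUnitary * diagonal (fun j => (f (hB.eigenvalues j) : ℂ)) := by
    rw [hB.cfc_eq, IsHermitian.cfc, Unitary.conjStarAlgAut_apply, mul_assoc,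
      Unitary.coe_star_mul_self, mul_one]
    rfl
  rw [eigenCoeff_apply, eigenCoeff_apply, mul_assoc, mul_assoc, hcfc, ← mul_assoc, ← mul_assoc,
    mul_diagonal, mul_comm]

theorem eigenCoeff_mul_left (Z : Matrix d d ℂ) (k : d × d) :
    eigenCoeff hA hB (A * Z) k = hA.eigenvalues k.1 * eigenCoeff hA hB Z k := by
  have h := eigenCoeff_cfc_mul hA hB id Z k
  rwa [cfc_id ℝ A hA.isSelfAdjoint] at h

theorem eigenCoeff_mul_right (Z : Matrix d d ℂ) (k : d × d) :
    eigenCoeff hA hB (Z * B) k = hB.eigenvalues k.2 * eigenCoeff hA hB Z k := by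
  have h := eigenCoeff_mul_cfc hA hB id Z k
  rwa [cfc_id ℝ B hB.isSelfAdjoint] at h

theorem eigenCoeff_self_left (k : d × d) :
    eigenCoeff hA hB A k = hA.eigenvalues k.1 * eigenCoeff hA hB 1 k := by
  have h := eigenCoeff_mul_left hA hB 1 k
  rwa [mul_one] at h

theorem eigenCoeff_self_right (k : d × d) :
    eigenCoeff hA hB B k = hB.eigenvalues k.2 * eigenCoeff hA hB 1 k := by
  have h := eigenCoeff_mul_right hA hB 1 k
  rwa [one_mul] at h

theorem eigenCoeff_sub (k : d × d) :
    eigenCoeff hA hB (A - B) k =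
      ((hA.eigenvalues k.1 - hB.eigenvalues k.2 : ℝ) : ℂ) * eigenCoeff hA hB 1 k := by
  rw [map_sub, Pi.sub_apply, eigenCoeff_self_left, eigenCoeff_self_right, Complex.ofReal_sub,
    sub_mul]

theorem trace_mul_conjTranspose_eq_sum_eigenCoeff (Z W : Matrix d d ℂ) :
    (Z * Wᴴ).trace = ∑ k, eigenCoeff hA hB Z k * star (eigenCoeff hA hB W k) := by
  set U := (hA.eigenvectorUnitary : Matrix d d ℂ)
  set V := (hB.eigenvectorUnitary : Matrix d d ℂ)
  have hU : U * star U = 1 := Unitary.coe_mul_star_self _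
  have hV : V * star V = 1 := Unitary.coe_mul_star_self _
  calc (Z * Wᴴ).trace = ((star U * Z * V) * (star U * W * V)ᴴ).trace := by
        rw [conjTranspose_mul, conjTranspose_mul, star_eq_conjTranspose,
          conjTranspose_conjTranspose, ← star_eq_conjTranspose U, ← star_eq_conjTranspose V,
          mul_assoc (star U * Z), ← mul_assoc V, hV, one_mul, mul_assoc (star U),
          trace_mul_comm (star U), mul_assoc, mul_assoc, hU, mul_one]
    _ = ∑ k, eigenCoeff hA hB Z k * star (eigenCoeff hA hB W k) := by
        rw [Fintype.sum_prod_type]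
        rfl

theorem trace_eq_sum_eigenCoeff (Z : Matrix d d ℂ) :
    Z.trace = ∑ k, eigenCoeff hA hB Z k * star (eigenCoeff hA hB 1 k) := by
  rw [← trace_mul_conjTranspose_eq_sum_eigenCoeff, conjTranspose_one, mul_one]

theorem re_ofReal_mul_mul_star (c : ℝ) (z : ℂ) : ((c : ℂ) * z * star z).re = c * ‖z‖ ^ 2 := by
  rw [mul_assoc, Complex.re_ofReal_mul, Complex.star_def, Complex.mul_conj']
  norm_cast

open scoped Matrix.Norms.Frobenius in
theorem frobenius_norm_sq_eq_sum_eigenCoeff (Z : Matrix d d ℂ) :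
    ‖Z‖ ^ 2 = ∑ k, ‖eigenCoeff hA hB Z k‖ ^ 2 := by
  have htrace : ((‖Z‖ ^ 2 : ℝ) : ℂ) = (Z * Zᴴ).trace := by
    rw [frobenius_norm_def, ← Real.sqrt_eq_rpow, Real.sq_sqrt (by positivity), Complex.ofReal_sum]
    refine Finset.sum_congr rfl fun i _ => ?_
    simp [Matrix.mul_apply, Complex.mul_conj']
  rw [trace_mul_conjTranspose_eq_sum_eigenCoeff hA hB] at htrace
  exact_mod_cast htrace.trans (Finset.sum_congr rfl fun k _ => Complex.mul_conj' _)

end EigenbasisCoefficients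

section MixtureInequalities

variable {V : Type*} [NormedAddCommGroup V] [InnerProductSpace ℝ V]

theorem eq_zero_of_mixture_eq_zero {a b t : ℝ} (ha : 0 ≤ a) (hb : 0 ≤ b) (ht : t ∈ Set.Ioo 0 1)
    (h : t * a + (1 - t) * b = 0) : a = 0 ∧ b = 0 := by
  have ht' : 0 < 1 - t := sub_pos.2 ht.2
  rw [add_eq_zero_iff_of_nonneg (mul_nonneg ht.1.le ha) (mul_nonneg ht'.le hb)] at h
  exact ⟨(mul_eq_zero_iff_left ht.1.ne').1 h.1, (mul_eq_zero_iff_left ht'.ne').1 h.2⟩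

theorem sub_eq_zero_of_mixture_eq_zero {a b t : ℝ} (ha : 0 ≤ a) (hb : 0 ≤ b)
    (ht : t ∈ Set.Ioo 0 1) (h : t * a + (1 - t) * b = 0) : a - b = 0 := by
  obtain ⟨ha0, hb0⟩ := eq_zero_of_mixture_eq_zero ha hb ht h
  rw [ha0, hb0, sub_self]

theorem two_mul_inner_sub_norm_sq_eq {r δ : ℝ} (h : r = 0 → δ = 0) (w x : V) :
    2 * (δ * inner ℝ x w) - r * ‖x‖ ^ 2 = ‖w‖ ^ 2 * (δ ^ 2 / r) - ‖r • x - δ • w‖ ^ 2 / r := by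
  by_cases hr : r = 0
  · simp [hr, h hr]
  · rw [norm_sub_sq_real, norm_smul, norm_smul, inner_smul_left, inner_smul_right,
      mul_pow, mul_pow, Real.norm_eq_abs, Real.norm_eq_abs, sq_abs, sq_abs,
      conj_trivial]
    field_simp
    ring

theorem norm_smul_sub_smul_sq_le {a b t : ℝ} (ha : a ∈ Set.Icc 0 1) (hb : b ∈ Set.Icc 0 1)
    (ht : t ∈ Set.Ioo 0 1) (w x : V) :
    ‖((1 - t) * b) • x - (a - b) • w‖ ^ 2 ≤
      ‖(t * a + (1 - t) * b) • x - (a - b) • w‖ ^ 2 / (t * a + (1 - t) * b) +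
        t * (‖w‖ ^ 2 * ((a - b) ^ 2 / (t * a + (1 - t) * b))) := by
  set r := t * a + (1 - t) * b with hr_def
  set y := r • x - (a - b) • w with hy
  have hta : 0 ≤ t * a := mul_nonneg ht.1.le ha.1
  have htb : 0 ≤ (1 - t) * b := mul_nonneg (sub_nonneg.2 ht.2.le) hb.1
  rcases (add_nonneg hta htb).eq_or_lt with hr | hr <;> rw [← hr_def] at hr
  · obtain ⟨ha0, hb0⟩ := eq_zero_of_mixture_eq_zero ha.1 hb.1 ht hr.symm
    simp [ha0, hb0, ← hr]
  have hweights : (1 - t) * b / r + t * a / r = 1 := by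
    rw [← add_div, add_comm, ← hr_def, div_self hr.ne']
  have hcomb : ((1 - t) * b) • x - (a - b) • w =
      ((1 - t) * b / r) • y + (t * a / r) • (-((a - b) • w)) :=
    calc ((1 - t) * b) • x - (a - b) • w
        = ((1 - t) * b / r * r) • x - ((1 - t) * b / r + t * a / r) • (a - b) • w := by
          rw [hweights, one_smul, div_mul_cancel₀ _ hr.ne']
      _ = ((1 - t) * b / r) • y + (t * a / r) • (-((a - b) • w)) := by
          rw [hy]
          module
  calc ‖((1 - t) * b) • x - (a - b) • w‖ ^ 2
      ≤ (1 - t) * b / r * ‖y‖ ^ 2 + t * a / r * ‖-((a - b) • w)‖ ^ 2 := by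
        rw [hcomb]
        exact ((convexOn_univ_norm (E := V)).pow (fun _ _ => norm_nonneg _) 2).2 (Set.mem_univ y)
          (Set.mem_univ (-((a - b) • w))) (div_nonneg htb hr.le) (div_nonneg hta hr.le) hweights
    _ ≤ 1 / r * ‖y‖ ^ 2 + t / r * ‖-((a - b) • w)‖ ^ 2 := by
        gcongr
        · exact mul_le_one₀ (sub_le_self _ ht.1.le) hb.1 hb.2
        · exact mul_le_of_le_one_right ht.1.le ha.2
    _ = ‖y‖ ^ 2 / r + t * (‖w‖ ^ 2 * ((a - b) ^ 2 / r)) := by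
        rw [norm_neg, norm_smul, mul_pow, Real.norm_eq_abs, sq_abs]
        ring

end MixtureInequalities

section NussbaumSzkola

variable {d : Type*} [Fintype d] [DecidableEq d] {A B X : Matrix d d ℂ} {t : ℝ}

/-- The first Nussbaum-Szkoła distribution `a_i |⟨u_i, v_j⟩|²` of `A = ∑ a_i |u_i⟩⟨u_i|` and
`B = ∑ b_j |v_j⟩⟨v_j|`. -/
noncomputable def nussbaumSzkolaFst (hA : A.IsHermitian) (hB : B.IsHermitian) (k : d × d) : ℝ :=
  hA.eigenvalues k.1 * ‖eigenCoeff hA hB 1 k‖ ^ 2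

/-- The second Nussbaum-Szkoła distribution `b_j |⟨u_i, v_j⟩|²` of `A = ∑ a_i |u_i⟩⟨u_i|` and
`B = ∑ b_j |v_j⟩⟨v_j|`. -/
noncomputable def nussbaumSzkolaSnd (hA : A.IsHermitian) (hB : B.IsHermitian) (k : d × d) : ℝ :=
  hB.eigenvalues k.2 * ‖eigenCoeff hA hB 1 k‖ ^ 2

theorem chiSq_nussbaumSzkola (hA : A.IsHermitian) (hB : B.IsHermitian) (t : ℝ) :
    chiSq (nussbaumSzkolaFst hA hB) (nussbaumSzkolaSnd hA hB) t =
      ∑ k, ‖eigenCoeff hA hB 1 k‖ ^ 2 * ((hA.eigenvalues k.1 - hB.eigenvalues k.2) ^ 2 /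
        (t * hA.eigenvalues k.1 + (1 - t) * hB.eigenvalues k.2)) := by
  refine Finset.sum_congr rfl fun k _ => ?_
  rw [nussbaumSzkolaFst, nussbaumSzkolaSnd]
  by_cases hw : ‖eigenCoeff hA hB 1 k‖ = 0
  · simp [hw]
  · rw [← sub_mul, ← mul_assoc, ← mul_assoc, ← add_mul, mul_pow, pow_two (‖_‖ ^ 2), ← mul_assoc,
      mul_div_mul_right _ _ (pow_ne_zero 2 hw), mul_comm, mul_div_assoc]

/-- A functional of the observable `X` whose maximum over Hermitian `X` is a quantum
`χ²`-divergence of `A` and `B` relative to the mixture `t A + (1 - t) B`. -/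
noncomputable def variationalChiSq (A B : Matrix d d ℂ) (t : ℝ) (X : Matrix d d ℂ) : ℝ :=
  2 * ((A - B) * X).trace.re -
    (t * (A * (X * X)).trace.re + (1 - t) * (B * (X * X)).trace.re)

theorem variationalChiSq_eq_sum (hA : A.IsHermitian) (hB : B.IsHermitian) (hX : X.IsHermitian)
    (t : ℝ) :
    variationalChiSq A B t X = ∑ k,
      (2 * ((hA.eigenvalues k.1 - hB.eigenvalues k.2) *
        inner ℝ (eigenCoeff hA hB X k) (eigenCoeff hA hB 1 k)) -
      (t * hA.eigenvalues k.1 + (1 - t) * hB.eigenvalues k.2) * ‖eigenCoeff hA hB X k‖ ^ 2) := by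
  have hdiff : ((A - B) * X).trace.re = ∑ k, (hA.eigenvalues k.1 - hB.eigenvalues k.2) *
      inner ℝ (eigenCoeff hA hB X k) (eigenCoeff hA hB 1 k) := by
    nth_rw 1 [← hX.eq]
    rw [trace_mul_conjTranspose_eq_sum_eigenCoeff hA hB, Complex.re_sum]
    refine Finset.sum_congr rfl fun k _ => ?_
    rw [eigenCoeff_sub, mul_assoc, Complex.re_ofReal_mul]
    rfl
  have hsqA : (A * (X * X)).trace.re =
      ∑ k, hA.eigenvalues k.1 * ‖eigenCoeff hA hB X k‖ ^ 2 := by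
    nth_rw 2 [← hX.eq]
    rw [← mul_assoc, trace_mul_conjTranspose_eq_sum_eigenCoeff hA hB, Complex.re_sum]
    refine Finset.sum_congr rfl fun k _ => ?_
    rw [eigenCoeff_mul_left, re_ofReal_mul_mul_star]
  have hsqB : (B * (X * X)).trace.re =
      ∑ k, hB.eigenvalues k.2 * ‖eigenCoeff hA hB X k‖ ^ 2 := by
    rw [← mul_assoc, trace_mul_cycle]
    nth_rw 2 [← hX.eq]
    rw [trace_mul_conjTranspose_eq_sum_eigenCoeff hA hB, Complex.re_sum]
    refine Finset.sum_congr rfl fun k _ => ?_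
    rw [eigenCoeff_mul_right, re_ofReal_mul_mul_star]
  simp only [variationalChiSq, hdiff, hsqA, hsqB, Finset.mul_sum, ← Finset.sum_add_distrib,
    ← Finset.sum_sub_distrib]
  exact Finset.sum_congr rfl fun k _ => by ring

theorem variationalChiSq_le_chiSq (hA : A.PosSemidef) (hB : B.PosSemidef) (hX : X.IsHermitian)
    (ht : t ∈ Set.Ioo 0 1) :
    variationalChiSq A B t X ≤ chiSq (nussbaumSzkolaFst hA.isHermitian hB.isHermitian)
      (nussbaumSzkolaSnd hA.isHermitian hB.isHermitian) t := by
  rw [variationalChiSq_eq_sum hA.isHermitian hB.isHermitian hX, chiSq_nussbaumSzkola]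
  refine Finset.sum_le_sum fun k _ => ?_
  have ha := hA.eigenvalues_nonneg k.1
  have hb := hB.eigenvalues_nonneg k.2
  have hr := add_nonneg (mul_nonneg ht.1.le ha) (mul_nonneg (sub_nonneg.2 ht.2.le) hb)
  rw [two_mul_inner_sub_norm_sq_eq (sub_eq_zero_of_mixture_eq_zero ha hb ht)]
  exact sub_le_self _ (div_nonneg (sq_nonneg _) hr)

open scoped Matrix.Norms.Frobenius

theorem variationalChiSq_add_norm_sq_le (hA : A.PosSemidef) (hB : B.PosSemidef)
    (hA1 : ∀ i, hA.isHermitian.eigenvalues i ≤ 1) (hB1 : ∀ i, hB.isHermitian.eigenvalues i ≤ 1)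
    (hX : X.IsHermitian) (ht : t ∈ Set.Ioo 0 1) :
    variationalChiSq A B t X + ‖((1 - t) • X) * B - (A - B)‖ ^ 2 ≤
      (1 + t) * chiSq (nussbaumSzkolaFst hA.isHermitian hB.isHermitian)
        (nussbaumSzkolaSnd hA.isHermitian hB.isHermitian) t := by
  rw [variationalChiSq_eq_sum hA.isHermitian hB.isHermitian hX, chiSq_nussbaumSzkola,
    frobenius_norm_sq_eq_sum_eigenCoeff hA.isHermitian hB.isHermitian, ← Finset.sum_add_distrib,
    Finset.mul_sum]
  refine Finset.sum_le_sum fun k _ => ?_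
  have ha := hA.eigenvalues_nonneg k.1
  have hb := hB.eigenvalues_nonneg k.2
  have hresidual : eigenCoeff hA.isHermitian hB.isHermitian (((1 - t) • X) * B - (A - B)) k =
      ((1 - t) * hB.isHermitian.eigenvalues k.2) • eigenCoeff hA.isHermitian hB.isHermitian X k -
        (hA.isHermitian.eigenvalues k.1 - hB.isHermitian.eigenvalues k.2) •
          eigenCoeff hA.isHermitian hB.isHermitian 1 k := by
    rw [map_sub, Pi.sub_apply, eigenCoeff_sub, smul_mul_assoc, LinearMap.map_smul_of_tower,
      Pi.smul_apply, eigenCoeff_mul_right, mul_smul, Complex.real_smul, Complex.real_smul,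
      Complex.real_smul, Complex.real_smul]
  rw [hresidual, two_mul_inner_sub_norm_sq_eq (sub_eq_zero_of_mixture_eq_zero ha hb ht)]
  linarith [norm_smul_sub_smul_sq_le ⟨ha, hA1 k.1⟩ ⟨hb, hB1 k.2⟩ ht
    (eigenCoeff hA.isHermitian hB.isHermitian 1 k) (eigenCoeff hA.isHermitian hB.isHermitian X k)]

theorem norm_commutator_le (hA : A.IsHermitian) (hB : B.IsHermitian) (hX : X.IsHermitian) :
    ‖A * B - B * A‖ ≤ 2 * (‖B‖ * ‖X * B - (A - B)‖) := by
  set T := X * B - (A - B) with hT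
  have hcomm : A * B - B * A = B * T - Tᴴ * B := by
    rw [hT, conjTranspose_sub, conjTranspose_sub, conjTranspose_mul, hA.eq, hB.eq, hX.eq]
    noncomm_ring
  calc ‖A * B - B * A‖ ≤ ‖B * T‖ + ‖Tᴴ * B‖ := hcomm ▸ norm_sub_le _ _
    _ ≤ ‖B‖ * ‖T‖ + ‖Tᴴ‖ * ‖B‖ := add_le_add (frobenius_norm_mul _ _) (frobenius_norm_mul _ _)
    _ = 2 * (‖B‖ * ‖T‖) := by rw [frobenius_norm_conjTranspose]; ring

end NussbaumSzkola

section NussbaumSzkolaPair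

variable {d : Type*} [Fintype d] [DecidableEq d] {A B : Matrix d d ℂ}

theorem sum_nussbaumSzkolaFst (hA : A.IsHermitian) (hB : B.IsHermitian) :
    ∑ k, nussbaumSzkolaFst hA hB k = A.trace.re := by
  rw [trace_eq_sum_eigenCoeff hA hB, Complex.re_sum]
  refine Finset.sum_congr rfl fun k _ => ?_
  rw [nussbaumSzkolaFst, ← re_ofReal_mul_mul_star, ← eigenCoeff_self_left]

theorem sum_nussbaumSzkolaSnd (hA : A.IsHermitian) (hB : B.IsHermitian) :
    ∑ k, nussbaumSzkolaSnd hA hB k = B.trace.re := by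
  rw [trace_eq_sum_eigenCoeff hA hB, Complex.re_sum]
  refine Finset.sum_congr rfl fun k _ => ?_
  rw [nussbaumSzkolaSnd, ← re_ofReal_mul_mul_star, ← eigenCoeff_self_right]

theorem eigenvalue_mul_eigenCoeff_one_eq_zero (hA : A.IsHermitian) (hB : B.IsHermitian)
    (hker : ∀ v : d → ℂ, B *ᵥ v = 0 → A *ᵥ v = 0) {k : d × d} (hk : hB.eigenvalues k.2 = 0) :
    hA.eigenvalues k.1 * eigenCoeff hA hB 1 k = 0 := by
  have hv : A *ᵥ (hB.eigenvectorBasis k.2) = 0 :=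
    hker _ (by rw [hB.mulVec_eigenvectorBasis, hk, zero_smul])
  rw [← eigenCoeff_self_left, eigenCoeff_apply, mul_assoc, Matrix.mul_apply]
  refine Finset.sum_eq_zero fun i _ => ?_
  have hcol : (A * (hB.eigenvectorUnitary : Matrix d d ℂ)) i k.2 =
      (A *ᵥ (hB.eigenvectorBasis k.2)) i := rfl
  rw [hcol, hv, Pi.zero_apply, mul_zero]

theorem isDominatedPair_nussbaumSzkola (hA : A.PosSemidef) (hB : B.PosSemidef)
    (htrace : A.trace = B.trace) (hker : ∀ v : d → ℂ, B *ᵥ v = 0 → A *ᵥ v = 0) :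
    IsDominatedPair (nussbaumSzkolaFst hA.isHermitian hB.isHermitian)
      (nussbaumSzkolaSnd hA.isHermitian hB.isHermitian) where
  fst_nonneg k := mul_nonneg (hA.eigenvalues_nonneg _) (sq_nonneg _)
  snd_nonneg k := mul_nonneg (hB.eigenvalues_nonneg _) (sq_nonneg _)
  sum_eq := by rw [sum_nussbaumSzkolaFst, sum_nussbaumSzkolaSnd, htrace]
  fst_eq_zero k hk := by
    rw [nussbaumSzkolaFst, mul_eq_zero, sq_eq_zero_iff, norm_eq_zero]
    rcases mul_eq_zero.1 hk with hb | hw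
    · exact (mul_eq_zero.1 (eigenvalue_mul_eigenCoeff_one_eq_zero _ _ hker hb)).imp_left
        Complex.ofReal_eq_zero.1
    · exact Or.inr (norm_eq_zero.1 (sq_eq_zero_iff.1 hw))

theorem DensityMatrix.isDominatedPair_nussbaumSzkola {ρ₀ ρ₁ : DensityMatrix d}
    (hker : ∀ v : d → ℂ, ρ₁.mat *ᵥ v = 0 → ρ₀.mat *ᵥ v = 0) :
    IsDominatedPair
      (nussbaumSzkolaFst ρ₀.posSemidef.isHermitian ρ₁.posSemidef.isHermitian)
      (nussbaumSzkolaSnd ρ₀.posSemidef.isHermitian ρ₁.posSemidef.isHermitian) :=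
  _root_.isDominatedPair_nussbaumSzkola ρ₀.posSemidef ρ₁.posSemidef
    (ρ₀.trace_eq_one.trans ρ₁.trace_eq_one.symm) hker

theorem umegakiInformation_eq_relativeInformation (ρ₀ ρ₁ : DensityMatrix d)
    (hker : ∀ v : d → ℂ, ρ₁.mat *ᵥ v = 0 → ρ₀.mat *ᵥ v = 0) :
    umegakiInformation ρ₀ ρ₁ =
      relativeInformation (nussbaumSzkolaFst ρ₀.posSemidef.isHermitian ρ₁.posSemidef.isHermitian)
        (nussbaumSzkolaSnd ρ₀.posSemidef.isHermitian ρ₁.posSemidef.isHermitian) := by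
  have hA := ρ₀.posSemidef.isHermitian
  have hB := ρ₁.posSemidef.isHermitian
  rw [umegakiInformation, trace_eq_sum_eigenCoeff hA hB, Complex.re_sum]
  refine Finset.sum_congr rfl fun k _ => ?_
  have hcoeff : eigenCoeff hA hB (ρ₀.mat * cfc Real.log ρ₀.mat - ρ₀.mat * cfc Real.log ρ₁.mat) k =
      ((hA.eigenvalues k.1 * (Real.log (hA.eigenvalues k.1) - Real.log (hB.eigenvalues k.2)) : ℝ)
        : ℂ) * eigenCoeff hA hB 1 k := by
    have hlog₀ := eigenCoeff_cfc_mul hA hB Real.log 1 k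
    have hlog₁ := eigenCoeff_mul_cfc hA hB Real.log 1 k
    rw [mul_one] at hlog₀
    rw [one_mul] at hlog₁
    rw [map_sub, Pi.sub_apply, eigenCoeff_mul_left, eigenCoeff_mul_left, hlog₀, hlog₁]
    push_cast
    ring
  rw [hcoeff, re_ofReal_mul_mul_star, mul_right_comm, ← nussbaumSzkolaFst]
  by_cases hp : nussbaumSzkolaFst hA hB k = 0
  · rw [hp, zero_mul, zero_mul]
  · have hq : nussbaumSzkolaSnd hA hB k ≠ 0 := fun hq =>
      hp ((DensityMatrix.isDominatedPair_nussbaumSzkola hker).fst_eq_zero k hq)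
    rw [← Real.log_div (left_ne_zero_of_mul hp) (left_ne_zero_of_mul hq), nussbaumSzkolaFst,
      nussbaumSzkolaSnd, mul_div_mul_right _ _ (right_ne_zero_of_mul hp)]

theorem DensityMatrix.eigenvalues_le_one (ρ : DensityMatrix d) (i : d) :
    ρ.posSemidef.isHermitian.eigenvalues i ≤ 1 := by
  have hsum : ∑ j, ρ.posSemidef.isHermitian.eigenvalues j = 1 := by
    have htrace := ρ.posSemidef.isHermitian.trace_eq_sum_eigenvalues
    rw [ρ.trace_eq_one] at htrace
    simpa using congrArg Complex.re htrace.symm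
  rw [← hsum]
  exact Finset.single_le_sum (fun j _ => ρ.posSemidef.eigenvalues_nonneg j) (Finset.mem_univ i)

open scoped Matrix.Norms.Frobenius in
theorem DensityMatrix.norm_le_one (ρ : DensityMatrix d) : ‖ρ.mat‖ ≤ 1 := by
  have h := ρ.posSemidef.isHermitian
  rw [← sq_le_one_iff₀ (norm_nonneg _), frobenius_norm_sq_eq_sum_eigenCoeff h h]
  calc ∑ k, ‖eigenCoeff h h ρ.mat k‖ ^ 2 ≤ ∑ k, nussbaumSzkolaFst h h k := by
        refine Finset.sum_le_sum fun k _ => ?_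
        have hk := ρ.posSemidef.eigenvalues_nonneg k.1
        rw [eigenCoeff_self_left, norm_mul, mul_pow, Complex.norm_real,
          Real.norm_eq_abs, sq_abs, nussbaumSzkolaFst]
        gcongr
        exact pow_le_of_le_one hk (ρ.eigenvalues_le_one _) two_ne_zero
    _ = 1 := by rw [sum_nussbaumSzkolaFst, ρ.trace_eq_one, Complex.one_re]

end NussbaumSzkolaPair

section Measurement

theorem mul_eq_zero_of_mulVec_eq_zero {l m n o R : Type*} [Fintype n] [NonUnitalNonAssocSemiring R]
    {A : Matrix l n R} {B : Matrix m n R} (hker : ∀ v : n → R, B *ᵥ v = 0 → A *ᵥ v = 0)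
    {Z : Matrix n o R} (h : B * Z = 0) : A * Z = 0 := by
  ext i j
  exact congrFun (hker (Z.col j) (funext fun i => congrFun (congrFun h i) j)) i

variable {d : Type*} [Fintype d] {A B : Matrix d d ℂ}

theorem exists_eq_conjTranspose_mul_self_of_posSemidef (hA : A.PosSemidef) :
    ∃ G : Matrix d d ℂ, A = Gᴴ * G := by
  classical
  open scoped MatrixOrder Matrix.Norms.L2Operator in
  exact CStarAlgebra.nonneg_iff_eq_star_mul_self.mp hA.nonneg

theorem trace_mul_nonneg_of_posSemidef (hA : A.PosSemidef) (hB : B.PosSemidef) :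
    0 ≤ (A * B).trace := by
  obtain ⟨G, rfl⟩ := exists_eq_conjTranspose_mul_self_of_posSemidef hA
  rw [mul_assoc, trace_mul_comm]
  exact (hB.mul_mul_conjTranspose_same G).trace_nonneg

theorem mul_eq_zero_of_trace_mul_eq_zero (hA : A.PosSemidef) (hB : B.PosSemidef)
    (h : (A * B).trace = 0) : A * B = 0 := by
  obtain ⟨G, rfl⟩ := exists_eq_conjTranspose_mul_self_of_posSemidef hA
  obtain ⟨F, rfl⟩ := exists_eq_conjTranspose_mul_self_of_posSemidef hB
  have hGF : G * Fᴴ = 0 := by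
    rw [← trace_mul_conjTranspose_self_eq_zero_iff, ← h, conjTranspose_mul,
      conjTranspose_conjTranspose, mul_assoc Gᴴ, trace_mul_comm Gᴴ]
    simp only [mul_assoc]
  rw [mul_assoc, ← mul_assoc G, hGF, zero_mul, mul_zero]

variable [DecidableEq d] {n : ℕ}

namespace POVM

theorem prob_nonneg (E : POVM d n) (ρ : DensityMatrix d) (k : Fin n) : 0 ≤ E.prob ρ k :=
  (Complex.nonneg_iff.1 (trace_mul_nonneg_of_posSemidef ρ.posSemidef (E.posSemidef k))).1

theorem sum_prob (E : POVM d n) (ρ : DensityMatrix d) : ∑ k, E.prob ρ k = 1 := by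
  simp only [prob, ← Complex.re_sum, ← trace_sum, ← Matrix.mul_sum, E.sum_eq_one, mul_one,
    ρ.trace_eq_one, Complex.one_re]

theorem isDominatedPair_prob (E : POVM d n) {ρ₀ ρ₁ : DensityMatrix d}
    (hker : ∀ v : d → ℂ, ρ₁.mat *ᵥ v = 0 → ρ₀.mat *ᵥ v = 0) :
    IsDominatedPair (E.prob ρ₀) (E.prob ρ₁) where
  fst_nonneg := E.prob_nonneg ρ₀
  snd_nonneg := E.prob_nonneg ρ₁
  sum_eq := by rw [sum_prob, sum_prob]
  fst_eq_zero k hk := by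
    have hnonneg := trace_mul_nonneg_of_posSemidef ρ₁.posSemidef (E.posSemidef k)
    have htrace : (ρ₁.mat * E.effect k).trace = 0 :=
      Complex.ext hk (Complex.nonneg_iff.1 hnonneg).2.symm
    have hmul := mul_eq_zero_of_trace_mul_eq_zero ρ₁.posSemidef (E.posSemidef k) htrace
    rw [prob, mul_eq_zero_of_mulVec_eq_zero hker hmul, trace_zero, Complex.zero_re]

/-- The observable that takes the value `c k` at the outcome `k`. -/
noncomputable def observable (E : POVM d n) (c : Fin n → ℝ) : Matrix d d ℂ :=
  ∑ k, (c k : ℂ) • E.effect k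

theorem isHermitian_observable (E : POVM d n) (c : Fin n → ℝ) : (E.observable c).IsHermitian := by
  simp only [IsHermitian, observable, conjTranspose_sum, conjTranspose_smul,
    (E.posSemidef _).isHermitian.eq, Complex.star_def, Complex.conj_ofReal]

theorem trace_mul_observable (E : POVM d n) (ρ : DensityMatrix d) (c : Fin n → ℝ) :
    (ρ.mat * E.observable c).trace.re = ∑ k, c k * E.prob ρ k := by
  simp [observable, Matrix.mul_sum, trace_sum, prob]

theorem posSemidef_observable_sq_sub (E : POVM d n) (c : Fin n → ℝ) :
    (E.observable (fun k => c k ^ 2) - E.observable c * E.observable c).PosSemidef := by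
  set X := E.observable c with hX
  have hherm (k : Fin n) : ((c k : ℂ) • 1 - X)ᴴ = (c k : ℂ) • 1 - X := by
    rw [conjTranspose_sub, hX, (E.isHermitian_observable c).eq, conjTranspose_smul,
      conjTranspose_one, Complex.star_def, Complex.conj_ofReal]
  have hexpand (k : Fin n) : ((c k : ℂ) • 1 - X) * E.effect k * ((c k : ℂ) • 1 - X)ᴴ =
      ((c k ^ 2 : ℝ) : ℂ) • E.effect k - X * ((c k : ℂ) • E.effect k)
        - ((c k : ℂ) • E.effect k) * X + X * E.effect k * X := by
    rw [hherm]
    simp only [sub_mul, mul_sub, smul_mul_assoc, mul_smul_comm, one_mul, mul_one, smul_sub,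
      smul_smul, Complex.ofReal_mul, pow_two]
    abel
  have hvariance : E.observable (fun k => c k ^ 2) - X * X =
      ∑ k, ((c k : ℂ) • 1 - X) * E.effect k * ((c k : ℂ) • 1 - X)ᴴ := by
    simp only [hexpand, Finset.sum_add_distrib, Finset.sum_sub_distrib, ← Finset.mul_sum,
      ← Finset.sum_mul, E.sum_eq_one, mul_one]
    rw [← observable, ← observable, ← hX, sub_add_cancel]
  rw [hvariance]
  exact posSemidef_sum _ fun k _ => (E.posSemidef k).mul_mul_conjTranspose_same _

theorem trace_mul_observable_mul_self_le (E : POVM d n) (ρ : DensityMatrix d) (c : Fin n → ℝ) :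
    (ρ.mat * (E.observable c * E.observable c)).trace.re ≤ ∑ k, c k ^ 2 * E.prob ρ k := by
  have h := (Complex.nonneg_iff.1
    (trace_mul_nonneg_of_posSemidef ρ.posSemidef (E.posSemidef_observable_sq_sub c))).1
  rwa [mul_sub, trace_sub, Complex.sub_re, E.trace_mul_observable, sub_nonneg] at h

theorem chiSq_prob_le_variationalChiSq (E : POVM d n) (ρ₀ ρ₁ : DensityMatrix d) {t : ℝ}
    (ht : t ∈ Set.Icc 0 1) :
    chiSq (E.prob ρ₀) (E.prob ρ₁) t ≤ variationalChiSq ρ₀.mat ρ₁.mat t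
      (E.observable (mixtureScore (E.prob ρ₀) (E.prob ρ₁) t)) := by
  set c := mixtureScore (E.prob ρ₀) (E.prob ρ₁) t
  have hsq₀ := mul_le_mul_of_nonneg_left (E.trace_mul_observable_mul_self_le ρ₀ c) ht.1
  have hsq₁ := mul_le_mul_of_nonneg_left (E.trace_mul_observable_mul_self_le ρ₁ c)
    (sub_nonneg.2 ht.2)
  rw [chiSq_eq_sum_mixtureScore, variationalChiSq, sub_mul ρ₀.mat, trace_sub,
    Complex.sub_re, trace_mul_observable, trace_mul_observable]
  linarith

end POVM

end Measurement

section MeasurementBound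

variable {d : Type*} [Fintype d] [DecidableEq d] {n : ℕ} {ρ₀ ρ₁ : DensityMatrix d} {t : ℝ}

theorem chiSq_prob_le_chiSq_nussbaumSzkola (E : POVM d n) (ht : t ∈ Set.Ioo 0 1) :
    chiSq (E.prob ρ₀) (E.prob ρ₁) t ≤
      chiSq (nussbaumSzkolaFst ρ₀.posSemidef.isHermitian ρ₁.posSemidef.isHermitian)
        (nussbaumSzkolaSnd ρ₀.posSemidef.isHermitian ρ₁.posSemidef.isHermitian) t :=
  (E.chiSq_prob_le_variationalChiSq ρ₀ ρ₁ (Set.Ioo_subset_Icc_self ht)).trans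
    (variationalChiSq_le_chiSq ρ₀.posSemidef ρ₁.posSemidef (E.isHermitian_observable _) ht)

open scoped Matrix.Norms.Frobenius in
theorem chiSq_prob_add_norm_commutator_sq_le (E : POVM d n) (ht : t ∈ Set.Ioo 0 1) :
    chiSq (E.prob ρ₀) (E.prob ρ₁) t + ‖ρ₀.mat * ρ₁.mat - ρ₁.mat * ρ₀.mat‖ ^ 2 / 4 ≤ (1 + t) *
      chiSq (nussbaumSzkolaFst ρ₀.posSemidef.isHermitian ρ₁.posSemidef.isHermitian)
        (nussbaumSzkolaSnd ρ₀.posSemidef.isHermitian ρ₁.posSemidef.isHermitian) t := by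
  set X := E.observable (mixtureScore (E.prob ρ₀) (E.prob ρ₁) t)
  have hX : X.IsHermitian := E.isHermitian_observable _
  set T := ((1 - t) • X) * ρ₁.mat - (ρ₀.mat - ρ₁.mat)
  have hcomm : ‖ρ₀.mat * ρ₁.mat - ρ₁.mat * ρ₀.mat‖ ≤ 2 * ‖T‖ :=
    calc ‖ρ₀.mat * ρ₁.mat - ρ₁.mat * ρ₀.mat‖ ≤ 2 * (‖ρ₁.mat‖ * ‖T‖) :=
          norm_commutator_le ρ₀.posSemidef.isHermitian ρ₁.posSemidef.isHermitian
            (hX.smul (IsSelfAdjoint.all (1 - t)))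
      _ ≤ 2 * ‖T‖ := by
          gcongr
          exact mul_le_of_le_one_left (norm_nonneg _) ρ₁.norm_le_one
  have hcomm_sq : ‖ρ₀.mat * ρ₁.mat - ρ₁.mat * ρ₀.mat‖ ^ 2 ≤ (2 * ‖T‖) ^ 2 := by gcongr
  have hvar := variationalChiSq_add_norm_sq_le ρ₀.posSemidef ρ₁.posSemidef ρ₀.eigenvalues_le_one
    ρ₁.eigenvalues_le_one hX ht
  have hchi := E.chiSq_prob_le_variationalChiSq ρ₀ ρ₁ (Set.Ioo_subset_Icc_self ht)
  linarith

theorem klInformation_le_umegakiInformation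
    (hker : ∀ v : d → ℂ, ρ₁.mat *ᵥ v = 0 → ρ₀.mat *ᵥ v = 0) (E : POVM d n) :
    klInformation (E.prob ρ₀) (E.prob ρ₁) ≤ umegakiInformation ρ₀ ρ₁ := by
  rw [umegakiInformation_eq_relativeInformation ρ₀ ρ₁ hker]
  exact (DensityMatrix.isDominatedPair_nussbaumSzkola hker).relativeInformation_le_of_chiSq_le
    (E.isDominatedPair_prob hker) fun _ => chiSq_prob_le_chiSq_nussbaumSzkola E

open scoped Matrix.Norms.Frobenius in
theorem exists_pos_klInformation_add_le
    (hker : ∀ v : d → ℂ, ρ₁.mat *ᵥ v = 0 → ρ₀.mat *ᵥ v = 0)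
    (hcomm : ¬ Commute ρ₀.mat ρ₁.mat) :
    ∃ ε > 0, ∀ (n : ℕ) (E : POVM d n),
      klInformation (E.prob ρ₀) (E.prob ρ₁) + ε ≤ umegakiInformation ρ₀ ρ₁ := by
  have hNS := DensityMatrix.isDominatedPair_nussbaumSzkola hker
  have hχ := hNS.chiSq_nonneg ⟨le_rfl, zero_le_one⟩
  have hc : 0 < ‖ρ₀.mat * ρ₁.mat - ρ₁.mat * ρ₀.mat‖ ^ 2 / 4 :=
    div_pos (pow_pos (norm_pos_iff.2 (sub_ne_zero.2 hcomm)) 2) four_pos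
  rw [umegakiInformation_eq_relativeInformation ρ₀ ρ₁ hker]
  refine ⟨_, ?_, fun n E => hNS.relativeInformation_add_le_of_chiSq_add_le
    (E.isDominatedPair_prob hker) (fun _ => chiSq_prob_le_chiSq_nussbaumSzkola E) hc.le
    fun _ => chiSq_prob_add_norm_commutator_sq_le E⟩
  positivity

end MeasurementBound

section CommutingPair

variable {d : Type*} [Fintype d] [DecidableEq d] {A B : Matrix d d ℂ}

/-- The orthogonal projection onto the eigenspace of a Hermitian matrix `A` at `x`, obtained from
the functional calculus; it is zero when `x` is not an eigenvalue. -/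
noncomputable def spectralProjection (A : Matrix d d ℂ) (x : ℝ) : Matrix d d ℂ :=
  cfc (fun y => if y = x then (1 : ℝ) else 0) A

theorem posSemidef_spectralProjection (A : Matrix d d ℂ) (x : ℝ) :
    (spectralProjection A x).PosSemidef := by
  open scoped MatrixOrder in
  exact LE.le.posSemidef (cfc_nonneg fun y _ => by split_ifs <;> norm_num)

theorem cfc_mul_spectralProjection (A : Matrix d d ℂ) (f : ℝ → ℝ) (x : ℝ) :
    cfc f A * spectralProjection A x = f x • spectralProjection A x := by
  have hcont (g : ℝ → ℝ) : ContinuousOn g (spectrum ℝ A) := finite_real_spectrum.continuousOn g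
  rw [spectralProjection, ← cfc_mul _ _ _ (hcont _) (hcont _), ← cfc_const_mul _ _ _ (hcont _)]
  refine cfc_congr fun y _ => ?_
  split_ifs with h
  · rw [h]
  · rw [mul_zero, mul_zero]

theorem sum_spectralProjection (hA : A.IsHermitian) :
    ∑ x ∈ (finite_real_spectrum (A := A)).toFinset, spectralProjection A x = 1 := by
  have hcont (g : ℝ → ℝ) : ContinuousOn g (spectrum ℝ A) := finite_real_spectrum.continuousOn g
  simp only [spectralProjection]
  rw [← cfc_sum _ _ _ fun x _ => hcont _, ← cfc_one ℝ A hA.isSelfAdjoint]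
  refine cfc_congr fun y hy => ?_
  rw [Finset.sum_apply, Finset.sum_ite_eq, if_pos (by simpa using hy), Pi.one_apply]

theorem commute_spectralProjection (h : Commute A B) (x y : ℝ) :
    Commute (spectralProjection A x) (spectralProjection B y) :=
  ((h.cfc_real _).symm.cfc_real _).symm

theorem posSemidef_spectralProjection_mul (h : Commute A B) (x y : ℝ) :
    (spectralProjection A x * spectralProjection B y).PosSemidef := by
  open scoped MatrixOrder Matrix.Norms.L2Operator in
  exact LE.le.posSemidef <| (commute_spectralProjection h x y).mul_nonneg
    (posSemidef_spectralProjection A x).nonneg (posSemidef_spectralProjection B y).nonneg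

/-- The POVM with the outcome set `ι`, whose elements are numbered by `Fintype.equivFin ι`. -/
noncomputable def POVM.ofFintype {ι : Type*} [Fintype ι] (F : ι → Matrix d d ℂ)
    (hF : ∀ k, (F k).PosSemidef) (hsum : ∑ k, F k = 1) : POVM d (Fintype.card ι) where
  effect k := F ((Fintype.equivFin ι).symm k)
  posSemidef _ := hF _
  sum_eq_one := by rw [Equiv.sum_comp (Fintype.equivFin ι).symm F, hsum]

/-- A POVM diagonalizes `A`, with the value `x k` at the outcome `k`, if the range of the effect at
`k` lies in the eigenspace of `A` at `x k`. The functional calculus expresses this for all functions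
of `A` at once; where the effect vanishes, `x k` is arbitrary. -/
def POVM.Diagonalizes {n : ℕ} (E : POVM d n) (A : Matrix d d ℂ) (x : Fin n → ℝ) : Prop :=
  ∀ (f : ℝ → ℝ) (k : Fin n), cfc f A * E.effect k = f (x k) • E.effect k

theorem exists_povm_diagonalizes_of_commute (hA : A.IsHermitian) (hB : B.IsHermitian)
    (h : Commute A B) :
    ∃ (n : ℕ) (E : POVM d n) (x y : Fin n → ℝ), E.Diagonalizes A x ∧ E.Diagonalizes B y := by
  set s := (finite_real_spectrum (A := A)).toFinset
  set t := (finite_real_spectrum (A := B)).toFinset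
  let F (k : s × t) : Matrix d d ℂ := spectralProjection A k.1 * spectralProjection B k.2
  have hF (k : s × t) : (F k).PosSemidef := posSemidef_spectralProjection_mul h k.1 k.2
  have hsum : ∑ k, F k = 1 := by
    rw [Fintype.sum_prod_type]
    simp only [F, ← Finset.mul_sum, ← Finset.sum_mul]
    rw [Finset.sum_coe_sort s (spectralProjection A), Finset.sum_coe_sort t (spectralProjection B),
      sum_spectralProjection hA, sum_spectralProjection hB, mul_one]
  let e := (Fintype.equivFin (s × t)).symm
  refine ⟨_, POVM.ofFintype F hF hsum, fun k => (e k).1, fun k => (e k).2,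
    fun f k => ?_, fun f k => ?_⟩
  · change cfc f A * F (e k) = _ • F (e k)
    rw [← mul_assoc, cfc_mul_spectralProjection, smul_mul_assoc]
  · change cfc f B * F (e k) = _ • F (e k)
    simp only [F]
    rw [(commute_spectralProjection h _ _).eq, ← mul_assoc, cfc_mul_spectralProjection,
      smul_mul_assoc]

variable {n : ℕ} {ρ ρ₀ ρ₁ : DensityMatrix d} {x y : Fin n → ℝ}

theorem POVM.Diagonalizes.mat_mul_effect {E : POVM d n} (hx : E.Diagonalizes ρ.mat x)
    (k : Fin n) : ρ.mat * E.effect k = x k • E.effect k := by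
  have h := hx id k
  rwa [cfc_id ℝ ρ.mat ρ.posSemidef.isHermitian.isSelfAdjoint] at h

theorem POVM.Diagonalizes.prob_eq {E : POVM d n} (hx : E.Diagonalizes ρ.mat x) (k : Fin n) :
    E.prob ρ k = x k * (E.effect k).trace.re := by
  rw [POVM.prob, hx.mat_mul_effect, trace_smul, Complex.smul_re, smul_eq_mul]

theorem POVM.Diagonalizes.re_trace_mul_cfc {E : POVM d n} (hx : E.Diagonalizes ρ₀.mat x)
    {B : Matrix d d ℂ} (hy : E.Diagonalizes B y) (f : ℝ → ℝ) :
    (ρ₀.mat * cfc f B).trace.re = ∑ k, E.prob ρ₀ k * f (y k) := by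
  rw [← mul_one (ρ₀.mat * _), ← E.sum_eq_one, Matrix.mul_sum, trace_sum, Complex.re_sum]
  refine Finset.sum_congr rfl fun k _ => ?_
  rw [mul_assoc, hy, mul_smul_comm, hx.mat_mul_effect, trace_smul, trace_smul, Complex.smul_re,
    Complex.smul_re, hx.prob_eq, smul_eq_mul, smul_eq_mul, mul_comm (f _)]

theorem klInformation_eq_umegakiInformation_of_diagonalizes
    (hker : ∀ v : d → ℂ, ρ₁.mat *ᵥ v = 0 → ρ₀.mat *ᵥ v = 0) {E : POVM d n}
    (hx : E.Diagonalizes ρ₀.mat x) (hy : E.Diagonalizes ρ₁.mat y) :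
    klInformation (E.prob ρ₀) (E.prob ρ₁) = umegakiInformation ρ₀ ρ₁ := by
  rw [umegakiInformation, trace_sub, Complex.sub_re, hx.re_trace_mul_cfc hx,
    hx.re_trace_mul_cfc hy, ← Finset.sum_sub_distrib, klInformation]
  refine Finset.sum_congr rfl fun k _ => ?_
  rcases eq_or_ne (E.prob ρ₀ k) 0 with h₀ | h₀
  · rw [h₀, zero_mul, zero_mul, zero_mul, sub_zero]
  · have h₁ : E.prob ρ₁ k ≠ 0 := mt ((E.isDominatedPair_prob hker).fst_eq_zero k) h₀
    rw [hx.prob_eq] at h₀ ⊢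
    rw [hy.prob_eq] at h₁ ⊢
    rw [mul_div_mul_right _ _ (right_ne_zero_of_mul h₀),
      Real.log_div (left_ne_zero_of_mul h₀) (left_ne_zero_of_mul h₁), mul_sub]

theorem exists_klInformation_eq_umegakiInformation_of_commute
    (hker : ∀ v : d → ℂ, ρ₁.mat *ᵥ v = 0 → ρ₀.mat *ᵥ v = 0) (hcomm : Commute ρ₀.mat ρ₁.mat) :
    ∃ (n : ℕ) (E : POVM d n),
      klInformation (E.prob ρ₀) (E.prob ρ₁) = umegakiInformation ρ₀ ρ₁ := by
  obtain ⟨n, E, x, y, hx, hy⟩ := exists_povm_diagonalizes_of_commute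
    ρ₀.posSemidef.isHermitian ρ₁.posSemidef.isHermitian hcomm
  exact ⟨n, E, klInformation_eq_umegakiInformation_of_diagonalizes hker hx hy⟩

end CommutingPair

section QuantumKullback

variable {d : Type*} [Fintype d] [DecidableEq d] {ρ₀ ρ₁ : DensityMatrix d}

theorem quantumKullback_le {C : ℝ}
    (h : ∀ (n : ℕ) (E : POVM d n), klInformation (E.prob ρ₀) (E.prob ρ₁) ≤ C) :
    quantumKullback ρ₀ ρ₁ ≤ C := by
  refine csSup_le ⟨_, 1, ⟨fun _ => 1, fun _ => PosSemidef.one, by simp⟩, rfl⟩ ?_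
  rintro _ ⟨n, E, rfl⟩
  exact h n E

theorem klInformation_le_quantumKullback
    (hker : ∀ v : d → ℂ, ρ₁.mat *ᵥ v = 0 → ρ₀.mat *ᵥ v = 0) {n : ℕ} (E : POVM d n) :
    klInformation (E.prob ρ₀) (E.prob ρ₁) ≤ quantumKullback ρ₀ ρ₁ := by
  refine le_csSup ⟨umegakiInformation ρ₀ ρ₁, ?_⟩ ⟨n, E, rfl⟩
  rintro _ ⟨m, F, rfl⟩
  exact klInformation_le_umegakiInformation hker F

theorem quantumKullback_lt_umegakiInformation
    (hker : ∀ v : d → ℂ, ρ₁.mat *ᵥ v = 0 → ρ₀.mat *ᵥ v = 0)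
    (hcomm : ¬ Commute ρ₀.mat ρ₁.mat) :
    quantumKullback ρ₀ ρ₁ < umegakiInformation ρ₀ ρ₁ := by
  obtain ⟨ε, hε, hgap⟩ := exists_pos_klInformation_add_le hker hcomm
  exact (quantumKullback_le fun n E => le_sub_right_of_add_le (hgap n E)).trans_lt
    (sub_lt_self _ hε)

end QuantumKullback

theorem mainTheorem4 {d : Type*} [Fintype d] [DecidableEq d] (ρ₀ ρ₁ : DensityMatrix d)
    (hker : ∀ v : d → ℂ, ρ₁.mat.mulVec v = 0 → ρ₀.mat.mulVec v = 0) :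
    (∀ (n : ℕ) (E : POVM d n),
      klInformation (E.prob ρ₀) (E.prob ρ₁) ≤ umegakiInformation ρ₀ ρ₁) ∧
    quantumKullback ρ₀ ρ₁ ≤ umegakiInformation ρ₀ ρ₁ ∧
    (quantumKullback ρ₀ ρ₁ = umegakiInformation ρ₀ ρ₁ ↔ Commute ρ₀.mat ρ₁.mat) ∧
    ((∃ (n : ℕ) (E : POVM d n),
      klInformation (E.prob ρ₀) (E.prob ρ₁) = umegakiInformation ρ₀ ρ₁) ↔
        Commute ρ₀.mat ρ₁.mat) := by
  have hle (n : ℕ) (E : POVM d n) := klInformation_le_umegakiInformation hker E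
  have hsup : quantumKullback ρ₀ ρ₁ ≤ umegakiInformation ρ₀ ρ₁ := quantumKullback_le hle
  have commute_of_eq (h : quantumKullback ρ₀ ρ₁ = umegakiInformation ρ₀ ρ₁) :
      Commute ρ₀.mat ρ₁.mat :=
    by_contra fun hcomm => (quantumKullback_lt_umegakiInformation hker hcomm).ne h
  have eq_of_attained : (∃ (n : ℕ) (E : POVM d n), klInformation (E.prob ρ₀) (E.prob ρ₁) =
      umegakiInformation ρ₀ ρ₁) → quantumKullback ρ₀ ρ₁ = umegakiInformation ρ₀ ρ₁ :=
    fun ⟨_, E, hE⟩ => hsup.antisymm (hE.ge.trans (klInformation_le_quantumKullback hker E))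
  have attained_of_commute := exists_klInformation_eq_umegakiInformation_of_commute hker
  exact ⟨hle, hsup, ⟨commute_of_eq, eq_of_attained ∘ attained_of_commute⟩,
    commute_of_eq ∘ eq_of_attained, attained_of_commute⟩
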